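/- All graphs are finite, simple, undirected and connected; $\partial$ denotes path-length distance. For a graph $\Gamma$ with vertex set $X$, adjacency matrix $A$ and a vertex $x$, let $\varepsilon=\max_{y\in X}\partial(x,y)$, let $V=\mathbb{C}^X$, and for $0\le i\le\varepsilon$ let $E_i^*\in \mathrm{Mat}_X(\mathbb{C})$ be the diagonal matrix whose $(y,y)$-entry is $1$ if $\partial(x,y)=i$ and $0$ otherwise. Put $L=\sum_{i=1}^{\varepsilon}E^*_{i-1}AE^*_i$ and $R=\sum_{i=0}^{\varepsilon-1}E^*_{i+1}AE^*_i$. A *parameter matrix* is a tridiagonal matrix $U=(e_{ij})_{1\le i,j\le\varepsilon}$ over $\mathbb{C}$ such that (i) $e_{ii}=1$ for all $i$; (ii) either $e_{i,i-1}\ne 0$ for all $2\le i\le\varepsilon$, or $e_{i-1,i}\neq 0$ for all $2\le i\le\varepsilon$; (iii) the principal submatrix $(e_{ij})_{s\le i,j\le t}$ is nonsingular for all $1\le s\le t\le\varepsilon$. Write $e_i^-=e_{i,i-1}$ $(2\le i\le\varepsilon)$, $e_i^+=e_{i,i+1}$ $(1\le i\le\varepsilon-1)$ and $e_1^-=e_\varepsilon^+=0$.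 A *uniform structure* of a bipartite graph $\Gamma$ with respect to $x$ is a pair $(U,f)$ consisting of a parameter matrix $U$ and a vector $f=(f_i)_{i=1}^{\varepsilon}\in\mathbb{C}^\varepsilon$ such that, for $1\le i\le\varepsilon$, $$e_i^-RL^2+LRL+e_i^+L^2R=f_iL\quad\text{holds on } E_i^*V.$$ A non-bipartite graph $\Gamma$ *supports a uniform structure with respect to $x$* if the (bipartite, connected) graph $\Gamma_f=\Gamma_f(x)$, obtained from $\Gamma$ by deleting all edges $yz$ with $\partial(x,y)=\partial(x,z)$, admits a uniform structure with respect to $x$. **Corollary 9.3.** Let $\Gamma$ be (isomorphic to) one of the following graphs: * the Johnson graph $J(2D,D)$ with $D\ge 3$ (the $D$-subsets of a $2D$-set, adjacent when they meet in $D-1$ elements); * the Gosset graph (56 vertices, two copies of the set of 2-subsets of $\{1,\dots,8\}$; in the same copy two 2-subsets are adjacent when they meet in one element, in different copies they are adjacent when they are disjoint); * the halved cube $\tfrac12H(n,2)$ with $n$ even, $n\ge 6$ (the binary words of length $n$ and even weight, adjacent at Hamming distance $2$). Then for every vertex $x$ of $\Gamma$, $\Gamma$ does not support a uniform structure with respect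 to $x$. -/

import Mathlib

/-! ## Matrices attached to a vertex of a finite graph -/

section Terwilliger

variable {X : Type*} [Fintype X] [DecidableEq X]

/-- The eccentricity `ε(x) = max {∂(x, y) | y}`, where `∂` is the path-length distance
(the graphs considered are connected). -/
noncomputable def graphEcc (Γ : SimpleGraph X) (x : X) : ℕ :=
  Finset.univ.sup (fun y => Γ.dist x y)

/-- The `i`-th dual idempotent `E*_i` of `Γ` with respect to `x`. -/
noncomputable def dualIdempotent (Γ : SimpleGraph X) (x : X) (i : ℕ) : Matrix X X ℂ :=
  Matrix.diagonal (fun y => if Γ.dist x y = i then 1 else 0)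

open Classical in
/-- The adjacency matrix of `Γ` over `ℂ`. -/
noncomputable def complexAdjMatrix (Γ : SimpleGraph X) : Matrix X X ℂ :=
  Γ.adjMatrix ℂ

/-- The lowering matrix `L = ∑_{i=1}^{ε} E*_{i-1} A E*_i` of `Γ` with respect to `x`. -/
noncomputable def loweringMatrix (Γ : SimpleGraph X) (x : X) : Matrix X X ℂ :=
  ∑ i ∈ Finset.range (graphEcc Γ x),
    dualIdempotent Γ x i * complexAdjMatrix Γ * dualIdempotent Γ x (i + 1)

/-- The raising matrix `R = ∑_{i=0}^{ε-1} E*_{i+1} A E*_i` of `Γ` with respect to `x`. -/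
noncomputable def raisingMatrix (Γ : SimpleGraph X) (x : X) : Matrix X X ℂ :=
  ∑ i ∈ Finset.range (graphEcc Γ x),
    dualIdempotent Γ x (i + 1) * complexAdjMatrix Γ * dualIdempotent Γ x i

/-- The `i`-th subconstituent `E*_i V` of `Γ` with respect to `x`, a subspace of the standard
module `V = ℂ^X`. -/
noncomputable def subconstituent (Γ : SimpleGraph X) (x : X) (i : ℕ) : Submodule ℂ (X → ℂ) :=
  LinearMap.range (Matrix.mulVecLin (dualIdempotent Γ x i))

end Terwilliger

/-! ## Uniform structures -/

/-- `U = (e_{ij})_{1 ≤ i, j ≤ N}` is a parameter matrix.  The row and column with (one-based)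
number `i` have index `i - 1` in `Fin N`. -/
structure IsParameterMatrix {N : ℕ} (U : Matrix (Fin N) (Fin N) ℂ) : Prop where
  tridiagonal : ∀ i j : Fin N, ((i : ℕ) + 1 < j ∨ (j : ℕ) + 1 < i) → U i j = 0
  diag_eq_one : ∀ i : Fin N, U i i = 1
  offDiag_ne_zero :
    (∀ i j : Fin N, (j : ℕ) + 1 = i → U i j ≠ 0) ∨
    (∀ i j : Fin N, (i : ℕ) + 1 = j → U i j ≠ 0)
  /-- Every principal submatrix on a nonempty interval of indices `s ≤ i, j ≤ t` is nonsingular. -/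
  principal_nonsingular : ∀ s t : Fin N, s ≤ t →
    (U.submatrix (fun i : {i : Fin N // s ≤ i ∧ i ≤ t} => i.1)
      (fun j : {j : Fin N // s ≤ j ∧ j ≤ t} => j.1)).det ≠ 0

/-- `e⁻` of a row: the entry just left of the diagonal, and `0` for the first row. -/
noncomputable def eMinus {N : ℕ} (U : Matrix (Fin N) (Fin N) ℂ) (k : Fin N) : ℂ :=
  if 0 < (k : ℕ) then U k ⟨(k : ℕ) - 1, lt_of_le_of_lt (Nat.sub_le _ _) k.isLt⟩ else 0

/-- `e⁺` of a row: the entry just right of the diagonal, and `0` for the last row. -/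
noncomputable def ePlus {N : ℕ} (U : Matrix (Fin N) (Fin N) ℂ) (k : Fin N) : ℂ :=
  if h : (k : ℕ) + 1 < N then U k ⟨(k : ℕ) + 1, h⟩ else 0

section Uniform

variable {X : Type*} [Fintype X] [DecidableEq X]

/-- `(U, f)` is a uniform structure of the (connected, bipartite) graph `Γ` with respect to `x`:
`U` is a parameter matrix and `e⁻_i R L² + L R L + e⁺_i L² R = f_i L` holds on `E*_i V` for
`1 ≤ i ≤ ε(x)`.  The number `i` is `k + 1` for `k : Fin (ε(x))`. -/
structure IsUniformStructure (Γ : SimpleGraph X) (x : X)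
    (U : Matrix (Fin (graphEcc Γ x)) (Fin (graphEcc Γ x)) ℂ)
    (f : Fin (graphEcc Γ x) → ℂ) : Prop where
  isParameterMatrix : IsParameterMatrix U
  uniform : ∀ k : Fin (graphEcc Γ x), ∀ v ∈ subconstituent Γ x ((k : ℕ) + 1),
    Matrix.mulVec
      (eMinus U k • (raisingMatrix Γ x * loweringMatrix Γ x ^ 2)
        + loweringMatrix Γ x * raisingMatrix Γ x * loweringMatrix Γ x
        + ePlus U k • (loweringMatrix Γ x ^ 2 * raisingMatrix Γ x)) v
      = Matrix.mulVec (f k • loweringMatrix Γ x) v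

/-- `Γ` admits a uniform structure with respect to `x`. -/
def AdmitsUniformStructure (Γ : SimpleGraph X) (x : X) : Prop :=
  ∃ (U : Matrix (Fin (graphEcc Γ x)) (Fin (graphEcc Γ x)) ℂ) (f : Fin (graphEcc Γ x) → ℂ),
    IsUniformStructure Γ x U f

end Uniform

/-- The graph `Γ_f(x)`: delete from `Γ` all edges `yz` with `∂(x, y) = ∂(x, z)`. -/
def flatDeleted {X : Type*} (Γ : SimpleGraph X) (x : X) : SimpleGraph X where
  Adj y z := Γ.Adj y z ∧ Γ.dist x y ≠ Γ.dist x z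
  symm := ⟨fun _ _ h => ⟨h.1.symm, h.2.symm⟩⟩
  loopless := ⟨fun _ h => h.2 rfl⟩

/-- `Γ` supports a uniform structure with respect to `x`: the bipartite graph `Γ_f(x)` admits a
uniform structure with respect to `x`. -/
def SupportsUniformStructure {X : Type*} [Fintype X] [DecidableEq X]
    (Γ : SimpleGraph X) (x : X) : Prop :=
  AdmitsUniformStructure (flatDeleted Γ x) x

/-! ## The three families of graphs -/

/-- The Johnson graph `J(n, d)`: the `d`-subsets of an `n`-set, two of them being adjacent when
they meet in exactly `d - 1` elements. -/
def johnsonGraph (n d : ℕ) : SimpleGraph {s : Finset (Fin n) // s.card = d} where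
  Adj s t := (s.1 ∩ t.1).card + 1 = d
  symm := ⟨fun s t h => by rw [Finset.inter_comm]; exact h⟩
  loopless := ⟨fun s h => by rw [Finset.inter_self, s.2] at h; omega⟩

/-- The Gosset graph on 56 vertices: two copies of the set of edges (2-subsets) of the complete
graph on 8 points; two vertices in the same copy are adjacent when the edges share exactly one
point, two vertices in different copies are adjacent when the edges are disjoint. -/
def gossetGraph : SimpleGraph (Bool × {s : Finset (Fin 8) // s.card = 2}) where
  Adj u v := (u.1 = v.1 ∧ (u.2.1 ∩ v.2.1).card = 1) ∨ (u.1 ≠ v.1 ∧ Disjoint u.2.1 v.2.1)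
  symm := ⟨fun u v h => by
    rcases h with ⟨h, h'⟩ | ⟨h, h'⟩
    · exact Or.inl ⟨h.symm, by rw [Finset.inter_comm]; exact h'⟩
    · exact Or.inr ⟨h.symm, h'.symm⟩⟩
  loopless := ⟨fun u h => by
    rcases h with ⟨_, h⟩ | ⟨h, _⟩
    · rw [Finset.inter_self, u.2.2] at h; omega
    · exact h rfl⟩

/-- The halved cube `½H(n, 2)`: the binary words of length `n` and even weight (one bipartite half
of the hypercube `H(n, 2)`), two of them being adjacent at Hamming distance `2`. -/
def halvedCube (n : ℕ) : SimpleGraph {v : Fin n → ZMod 2 // Even (hammingNorm v)} where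
  Adj u v := hammingDist u.1 v.1 = 2
  symm := ⟨fun u v h => by rw [hammingDist_comm]; exact h⟩
  loopless := ⟨fun u h => by rw [hammingDist_self] at h; omega⟩

/-!
The raising and lowering matrices act on a thin Terwilliger module with layers `g_r, …, g_s` by
`R g_{i-1} = β_i g_i` and `L g_i = γ_{i-1} g_{i-1}`.  On it a uniform structure becomes the system
`e⁻_i d_{i-1} + d_i + e⁺_i d_{i+1} = f_i` (`r < i ≤ s`) for the products `d_i = γ_{i-1} β_i`, whose
coefficient matrix is a principal submatrix of the parameter matrix.  So the products depend only
on `r` and `s`, and two modules with the same `r` and `s` but different products rule out a uniform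
structure.  Each of the graphs has two such modules with `r = 1`: for Johnson graphs and halved
cubes they come from harmonic functions on a Boolean lattice, for the Gosset graph from two
eigenvalues of the adjacency between its middle layers.
-/

section Distance

variable {X Y : Type*} {Γ : SimpleGraph X} {Γ' : SimpleGraph Y} {x y : X}

theorem dist_map_le (f : Γ →g Γ') (h : Γ.Reachable x y) : Γ'.dist (f x) (f y) ≤ Γ.dist x y := by
  obtain ⟨p, hp⟩ := h.exists_walk_length_eq_dist
  exact hp ▸ p.length_map f ▸ SimpleGraph.dist_le (p.map f)

theorem dist_map_iso (e : Γ ≃g Γ') (x y : X) : Γ'.dist (e x) (e y) = Γ.dist x y := by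
  by_cases h : Γ.Reachable x y
  · refine le_antisymm (dist_map_le e.toHom h) ?_
    simpa using dist_map_le e.symm.toHom (e.reachable_iff.2 h)
  · rw [SimpleGraph.dist_eq_zero_of_not_reachable h,
      SimpleGraph.dist_eq_zero_of_not_reachable (mt e.reachable_iff.1 h)]

theorem exists_adj_dist_add_one_eq (h : Γ.Reachable x y) (hne : y ≠ x) :
    ∃ z, Γ.Adj z y ∧ Γ.dist x z + 1 = Γ.dist x y := by
  obtain ⟨p, hp⟩ := h.symm.exists_walk_length_eq_dist
  obtain ⟨z, hyz, q, rfl⟩ := SimpleGraph.Walk.exists_eq_cons_of_ne hne p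
  have hq := SimpleGraph.dist_le q
  have hdiff := hyz.symm.diff_dist_adj (u := x)
  rw [SimpleGraph.Walk.length_cons, SimpleGraph.dist_comm] at hp
  rw [SimpleGraph.dist_comm] at hq
  exact ⟨z, hyz.symm, by omega⟩

theorem exists_walk_length_eq {ℓ : X → ℕ}
    (hpred : ∀ y ≠ x, ∃ z, Γ.Adj z y ∧ ℓ z + 1 = ℓ y) (hx : ℓ x = 0) (y : X) :
    ∃ p : Γ.Walk x y, p.length = ℓ y := by
  induction hn : ℓ y generalizing y with
  | zero =>
    obtain rfl : y = x := by
      by_contra hne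
      obtain ⟨z, -, hz⟩ := hpred y hne
      omega
    exact ⟨.nil, rfl⟩
  | succ n ih =>
    obtain ⟨z, hzy, hz⟩ := hpred y (by rintro rfl; omega)
    obtain ⟨p, hp⟩ := ih z (by omega)
    exact ⟨p.concat hzy, by rw [SimpleGraph.Walk.length_concat, hp]⟩

theorem le_add_length {ℓ : X → ℕ} (hsucc : ∀ y z, Γ.Adj y z → ℓ z ≤ ℓ y + 1)
    (p : Γ.Walk x y) : ℓ y ≤ ℓ x + p.length := by
  induction p with
  | nil => simp
  | cons hadj p ih =>
    have := hsucc _ _ hadj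
    rw [SimpleGraph.Walk.length_cons]
    omega

theorem dist_eq_of_forall_adj {ℓ : X → ℕ} (hx : ℓ x = 0)
    (hsucc : ∀ y z, Γ.Adj y z → ℓ z ≤ ℓ y + 1)
    (hpred : ∀ y ≠ x, ∃ z, Γ.Adj z y ∧ ℓ z + 1 = ℓ y) (y : X) : Γ.dist x y = ℓ y := by
  obtain ⟨p, hp⟩ := exists_walk_length_eq hpred hx y
  obtain ⟨q, hq⟩ := p.reachable.exists_walk_length_eq_dist
  have := le_add_length hsucc q
  have := SimpleGraph.dist_le p
  omega

theorem flatDeleted_adj {y z : X} :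
    (flatDeleted Γ x).Adj y z ↔ Γ.Adj y z ∧ Γ.dist x y ≠ Γ.dist x z :=
  Iff.rfl

theorem flatDeleted_le (Γ : SimpleGraph X) (x : X) : flatDeleted Γ x ≤ Γ := fun _ _ h => h.1

theorem exists_flatDeleted_walk_length_eq_dist (h : Γ.Reachable x y) :
    ∃ p : (flatDeleted Γ x).Walk x y, p.length = Γ.dist x y := by
  induction hn : Γ.dist x y generalizing y with
  | zero =>
    obtain rfl := h.dist_eq_zero_iff.1 hn
    exact ⟨.nil, rfl⟩
  | succ n ih =>
    obtain ⟨z, hzy, hz⟩ := exists_adj_dist_add_one_eq h (by rintro rfl; simp at hn)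
    obtain ⟨p, hp⟩ := ih (h.trans hzy.symm.reachable) (by omega)
    have hadj : (flatDeleted Γ x).Adj z y := ⟨hzy, by omega⟩
    exact ⟨p.concat hadj, by rw [SimpleGraph.Walk.length_concat, hp]⟩

theorem flatDeleted_dist (Γ : SimpleGraph X) (x y : X) :
    (flatDeleted Γ x).dist x y = Γ.dist x y := by
  by_cases h : Γ.Reachable x y
  · obtain ⟨p, hp⟩ := exists_flatDeleted_walk_length_eq_dist h
    exact le_antisymm (hp ▸ SimpleGraph.dist_le p)
      (p.reachable.dist_anti (flatDeleted_le Γ x))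
  · rw [SimpleGraph.dist_eq_zero_of_not_reachable h,
      SimpleGraph.dist_eq_zero_of_not_reachable fun h' => h (h'.mono (flatDeleted_le Γ x))]

theorem dist_le_graphEcc [Fintype X] (Γ : SimpleGraph X) (x y : X) : Γ.dist x y ≤ graphEcc Γ x :=
  Finset.le_sup (f := fun y => Γ.dist x y) (Finset.mem_univ y)

end Distance

/-! ## Ladders -/

section Ladder

variable {X Y R S : Type*} [Fintype X] [Fintype Y] [CommRing R] [CommRing S]
  {Γ : SimpleGraph X} {Γ' : SimpleGraph Y} {x : X} {r s : ℕ} {g : X → R} {β γ : ℕ → R}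

open Classical in
/-- `g` is a *ladder* of `Γ` at `x` from layer `r` to layer `s`: its restrictions to the spheres of
radius `i` around `x`, `r ≤ i ≤ s`, span a nonzero subspace on which raising and lowering shift the
layer and multiply by `β (i + 1)` and `γ i` respectively.  This is a thin irreducible Terwilliger
module, presented by one vector, for a graph without edges inside the spheres. -/
structure IsLadder (Γ : SimpleGraph X) (x : X) (r s : ℕ) (g : X → R) (β γ : ℕ → R) : Prop where
  sum_lower : ∀ y, ∑ z with Γ.Adj y z ∧ Γ.dist x z + 1 = Γ.dist x y, g z = β (Γ.dist x y) * g y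
  sum_upper : ∀ y, ∑ z with Γ.Adj y z ∧ Γ.dist x z = Γ.dist x y + 1, g z = γ (Γ.dist x y) * g y
  lower_bottom : β r = 0
  upper_top : γ s = 0
  upper_ne_zero : ∀ i, r ≤ i → i < s → γ i ≠ 0
  bottom_ne_zero : ∃ y, Γ.dist x y = r ∧ g y ≠ 0

theorem IsLadder.comp_iso {g : Y → R} (e : Γ ≃g Γ') (h : IsLadder Γ' (e x) r s g β γ) :
    IsLadder Γ x r s (g ∘ e) β γ where
  sum_lower y := by
    classical
    rw [Function.comp_apply, ← dist_map_iso e, ← h.sum_lower, Finset.sum_filter, Finset.sum_filter]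
    exact Fintype.sum_equiv e.toEquiv _ _ fun z =>
      if_congr (by simp [dist_map_iso e, e.map_adj_iff]) rfl rfl
  sum_upper y := by
    classical
    rw [Function.comp_apply, ← dist_map_iso e, ← h.sum_upper, Finset.sum_filter, Finset.sum_filter]
    exact Fintype.sum_equiv e.toEquiv _ _ fun z =>
      if_congr (by simp [dist_map_iso e, e.map_adj_iff]) rfl rfl
  lower_bottom := h.lower_bottom
  upper_top := h.upper_top
  upper_ne_zero := h.upper_ne_zero
  bottom_ne_zero := by
    obtain ⟨y, hy, hgy⟩ := h.bottom_ne_zero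
    exact ⟨e.symm y, by rw [← dist_map_iso e, e.apply_symm_apply, hy], by simpa using hgy⟩

theorem IsLadder.map (h : IsLadder Γ x r s g β γ) {f : R →+* S} (hf : Function.Injective f) :
    IsLadder Γ x r s (f ∘ g) (f ∘ β) (f ∘ γ) where
  sum_lower y := by simpa using congrArg f (h.sum_lower y)
  sum_upper y := by simpa using congrArg f (h.sum_upper y)
  lower_bottom := by simp [h.lower_bottom]
  upper_top := by simp [h.upper_top]
  upper_ne_zero i hi his := (map_ne_zero_iff f hf).2 (h.upper_ne_zero i hi his)
  bottom_ne_zero := h.bottom_ne_zero.imp fun _ hy => ⟨hy.1, (map_ne_zero_iff f hf).2 hy.2⟩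

theorem IsLadder.flatDeleted (h : IsLadder Γ x r s g β γ) :
    IsLadder (flatDeleted Γ x) x r s g β γ where
  sum_lower y := by
    simp only [flatDeleted_dist, ← h.sum_lower]
    refine Finset.sum_congr (Finset.ext fun z => ?_) fun _ _ => rfl
    simp only [Finset.mem_filter_univ, flatDeleted_adj, flatDeleted_dist]
    exact and_congr_left fun hz => and_iff_left (by omega)
  sum_upper y := by
    simp only [flatDeleted_dist, ← h.sum_upper]
    refine Finset.sum_congr (Finset.ext fun z => ?_) fun _ _ => rfl
    simp only [Finset.mem_filter_univ, flatDeleted_adj, flatDeleted_dist]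
    exact and_congr_left fun hz => and_iff_left (by omega)
  lower_bottom := h.lower_bottom
  upper_top := h.upper_top
  upper_ne_zero := h.upper_ne_zero
  bottom_ne_zero := by simpa only [flatDeleted_dist] using h.bottom_ne_zero

theorem IsLadder.exists_ne_zero [NoZeroDivisors R] (h : IsLadder Γ x r s g β γ) {i : ℕ}
    (hri : r ≤ i) (his : i ≤ s) : ∃ y, Γ.dist x y = i ∧ g y ≠ 0 := by
  classical
  induction i, hri using Nat.le_induction with
  | base => exact h.bottom_ne_zero
  | succ i hri ih =>
    obtain ⟨y, hy, hgy⟩ := ih (by omega)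
    have hsum := mul_ne_zero (h.upper_ne_zero i hri his) hgy
    rw [← hy, ← h.sum_upper] at hsum
    obtain ⟨z, hz, hgz⟩ := Finset.exists_ne_zero_of_sum_ne_zero hsum
    exact ⟨z, by rw [(Finset.mem_filter.1 hz).2.2, hy], hgz⟩

end Ladder

/-! ## Raising and lowering -/

section Matrices

open Matrix

variable {X : Type*} [Fintype X] [DecidableEq X] {Γ : SimpleGraph X} {x : X}

theorem dualIdempotent_mulVec_apply (i : ℕ) (g : X → ℂ) (y : X) :
    (dualIdempotent Γ x i *ᵥ g) y = if Γ.dist x y = i then g y else 0 := by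
  simp [dualIdempotent, mulVec_diagonal]

open Classical in
theorem dualIdempotent_mul_adjMatrix_mul_apply (i j : ℕ) (y z : X) :
    (dualIdempotent Γ x i * complexAdjMatrix Γ * dualIdempotent Γ x j) y z
      = if i = Γ.dist x y then if Γ.Adj y z ∧ Γ.dist x z = j then 1 else 0 else 0 := by
  simp only [dualIdempotent, complexAdjMatrix, mul_diagonal, diagonal_mul,
    SimpleGraph.adjMatrix_apply]
  grind

open Classical in
theorem loweringMatrix_apply (y z : X) :
    loweringMatrix Γ x y z = if Γ.Adj y z ∧ Γ.dist x z = Γ.dist x y + 1 then 1 else 0 := by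
  have hz := dist_le_graphEcc Γ x z
  simp only [loweringMatrix, Matrix.sum_apply, dualIdempotent_mul_adjMatrix_mul_apply,
    Finset.sum_ite_eq', Finset.mem_range]
  grind

theorem transpose_loweringMatrix : (loweringMatrix Γ x)ᵀ = raisingMatrix Γ x := by
  simp [loweringMatrix, raisingMatrix, dualIdempotent, complexAdjMatrix, transpose_sum,
    transpose_mul, mul_assoc]

open Classical in
theorem loweringMatrix_mulVec_apply (v : X → ℂ) (y : X) :
    (loweringMatrix Γ x *ᵥ v) y
      = ∑ z with Γ.Adj y z ∧ Γ.dist x z = Γ.dist x y + 1, v z := by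
  simp only [mulVec, dotProduct, loweringMatrix_apply, ite_mul, one_mul, zero_mul,
    Finset.sum_filter]

open Classical in
theorem raisingMatrix_mulVec_apply (v : X → ℂ) (y : X) :
    (raisingMatrix Γ x *ᵥ v) y
      = ∑ z with Γ.Adj y z ∧ Γ.dist x z + 1 = Γ.dist x y, v z := by
  simp only [mulVec, dotProduct, ← transpose_loweringMatrix, transpose_apply,
    loweringMatrix_apply, ite_mul, one_mul, zero_mul, Finset.sum_filter, Γ.adj_comm,
    eq_comm (b := Γ.dist x y)]

variable {r s : ℕ} {g : X → ℂ} {β γ : ℕ → ℂ}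

theorem IsLadder.loweringMatrix_mulVec (h : IsLadder Γ x r s g β γ) (i : ℕ) :
    loweringMatrix Γ x *ᵥ (dualIdempotent Γ x (i + 1) *ᵥ g)
      = γ i • (dualIdempotent Γ x i *ᵥ g) := by
  classical
  ext y
  rw [Pi.smul_apply, smul_eq_mul, dualIdempotent_mulVec_apply, loweringMatrix_mulVec_apply]
  have hlayer : ∀ z ∈ ({z | Γ.Adj y z ∧ Γ.dist x z = Γ.dist x y + 1} : Finset X),
      (dualIdempotent Γ x (i + 1) *ᵥ g) z = if Γ.dist x y = i then g z else 0 := by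
    intro z hz
    simp [dualIdempotent_mulVec_apply, (Finset.mem_filter_univ _).1 hz]
  rw [Finset.sum_congr rfl hlayer]
  split_ifs with hy
  · rw [h.sum_upper, hy]
  · simp

theorem IsLadder.raisingMatrix_mulVec (h : IsLadder Γ x r s g β γ) (i : ℕ) :
    raisingMatrix Γ x *ᵥ (dualIdempotent Γ x i *ᵥ g)
      = β (i + 1) • (dualIdempotent Γ x (i + 1) *ᵥ g) := by
  classical
  ext y
  rw [Pi.smul_apply, smul_eq_mul, dualIdempotent_mulVec_apply, raisingMatrix_mulVec_apply]
  have hlayer : ∀ z ∈ ({z | Γ.Adj y z ∧ Γ.dist x z + 1 = Γ.dist x y} : Finset X),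
      (dualIdempotent Γ x i *ᵥ g) z = if Γ.dist x y = i + 1 then g z else 0 := by
    intro z hz
    simp [dualIdempotent_mulVec_apply, ← ((Finset.mem_filter_univ _).1 hz).2]
  rw [Finset.sum_congr rfl hlayer]
  split_ifs with hy
  · rw [h.sum_lower, hy]
  · simp

theorem IsLadder.uniformStructure_equation (h : IsLadder Γ x r s g β γ)
    {U : Matrix (Fin (graphEcc Γ x)) (Fin (graphEcc Γ x)) ℂ} {f : Fin (graphEcc Γ x) → ℂ}
    (hU : IsUniformStructure Γ x U f) {k : Fin (graphEcc Γ x)} (hr : r ≤ k) (hs : (k : ℕ) < s) :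
    eMinus U k * (γ (k - 1) * β k) + γ k * β (k + 1) + ePlus U k * (γ (k + 1) * β (k + 2))
      = f k := by
  obtain ⟨y, hy, hgy⟩ := h.exists_ne_zero hr hs.le
  have hRLL : eMinus U k • raisingMatrix Γ x *ᵥ loweringMatrix Γ x *ᵥ
      (dualIdempotent Γ x k *ᵥ g)
      = eMinus U k • (γ (k - 1) * β k) • (dualIdempotent Γ x k *ᵥ g) := by
    obtain hk | ⟨i, hk⟩ : (k : ℕ) = 0 ∨ ∃ i, (k : ℕ) = i + 1 := by
      cases (k : ℕ) <;> simp
    · simp [eMinus, hk]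
    · rw [hk, h.loweringMatrix_mulVec, mulVec_smul, h.raisingMatrix_mulVec, smul_smul (γ i),
        Nat.add_sub_cancel]
  have hv := hU.uniform k _ ⟨g, rfl⟩
  simp only [mulVecLin_apply, add_mulVec, smul_mulVec, ← mulVec_mulVec, pow_two,
    h.loweringMatrix_mulVec, h.raisingMatrix_mulVec, mulVec_smul, smul_smul] at hv hRLL
  have hvy := congrFun hv y
  have hy' := congrFun hRLL y
  simp only [Pi.add_apply, Pi.smul_apply, smul_eq_mul, dualIdempotent_mulVec_apply, hy,
    if_true] at hvy hy'
  refine mul_left_cancel₀ (mul_ne_zero (h.upper_ne_zero k hr hs) hgy) ?_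
  linear_combination hvy - γ k * hy'

end Matrices

section ParameterMatrix

variable {N : ℕ} {U : Matrix (Fin N) (Fin N) ℂ}

open Matrix

theorem IsParameterMatrix.mulVec_apply (hU : IsParameterMatrix U) (d : ℕ → ℂ) (k : Fin N) :
    (U *ᵥ fun j => d (j + 1)) k = eMinus U k * d k + d (k + 1) + ePlus U k * d (k + 2) := by
  have hminus : ∑ j : Fin N, (if (j : ℕ) + 1 = k then U k j * d (j + 1) else 0)
      = eMinus U k * d k := by
    obtain hk | hk := Nat.eq_zero_or_pos (k : ℕ)
    · simp [eMinus, hk]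
    · have hk' : (k : ℕ) - 1 + 1 = k := by omega
      rw [Finset.sum_eq_single ⟨k - 1, by omega⟩, eMinus, if_pos hk, if_pos hk', hk']
      · exact fun j _ hj => if_neg fun h => hj (Fin.ext (by simp only; omega))
      · simp
  have hplus : ∑ j : Fin N, (if (j : ℕ) = k + 1 then U k j * d (j + 1) else 0)
      = ePlus U k * d (k + 2) := by
    by_cases hk : (k : ℕ) + 1 < N
    · rw [Finset.sum_eq_single ⟨k + 1, hk⟩, ePlus, dif_pos hk, if_pos rfl]
      · exact fun j _ hj => if_neg fun h => hj (Fin.ext h)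
      · simp
    · rw [ePlus, dif_neg hk, zero_mul]
      exact Finset.sum_eq_zero fun j _ => if_neg (by omega)
  have hdiag : ∑ j : Fin N, (if j = k then d (j + 1) else 0) = d (k + 1) := by simp
  rw [← hminus, ← hplus, ← hdiag, ← Finset.sum_add_distrib, ← Finset.sum_add_distrib, mulVec,
    dotProduct]
  refine Finset.sum_congr rfl fun j _ => ?_
  obtain rfl | hjk := eq_or_ne j k
  · simp [hU.diag_eq_one]
  · have htri := hU.tridiagonal k j
    grind

theorem IsParameterMatrix.eq_zero_of_mulVec_eq_zero (hU : IsParameterMatrix U) {s t : Fin N}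
    {d : Fin N → ℂ} (hd : ∀ j, ¬(s ≤ j ∧ j ≤ t) → d j = 0)
    (hrow : ∀ k, s ≤ k → k ≤ t → (U *ᵥ d) k = 0) : d = 0 := by
  obtain hst | hst := lt_or_ge t s
  · exact funext fun j => hd j fun hj => hst.not_ge (hj.1.trans hj.2)
  have hsub := Matrix.eq_zero_of_mulVec_eq_zero (hU.principal_nonsingular s t hst)
    (v := fun j => d j.1) (by
      ext ⟨k, hk⟩
      rw [Pi.zero_apply, ← hrow k hk.1 hk.2]
      simp only [mulVec, dotProduct, submatrix_apply]
      refine Fintype.sum_of_injective Subtype.val Subtype.val_injective _ _ (fun j hj => ?_)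
        fun j => rfl
      rw [hd j (by simpa using hj), mul_zero])
  ext j
  by_cases hj : s ≤ j ∧ j ≤ t
  · exact congrFun hsub ⟨j, hj⟩
  · exact hd j hj

end ParameterMatrix

section Uniqueness

variable {X : Type*} [Fintype X] [DecidableEq X] {Γ : SimpleGraph X} {x : X} {r s : ℕ}
  {g g' : X → ℂ} {β γ β' γ' : ℕ → ℂ}

theorem IsLadder.mul_eq_mul_of_admitsUniformStructure (h : IsLadder Γ x r s g β γ)
    (h' : IsLadder Γ x r s g' β' γ') (hΓ : AdmitsUniformStructure Γ x) {i : ℕ}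
    (hri : r ≤ i) (his : i < s) : γ i * β (i + 1) = γ' i * β' (i + 1) := by
  obtain ⟨U, f, hU⟩ := hΓ
  obtain ⟨y, hy, -⟩ := h.exists_ne_zero (hri.trans his.le) le_rfl
  have hs : s ≤ graphEcc Γ x := hy ▸ dist_le_graphEcc Γ x y
  let d : ℕ → ℂ := (Set.Ioc r s).indicator fun j => γ (j - 1) * β j - γ' (j - 1) * β' j
  have hd : ∀ j, r ≤ j → j ≤ s + 1 → d j = γ (j - 1) * β j - γ' (j - 1) * β' j := by
    intro j hrj hjs
    refine Set.indicator_apply_eq_self.2 fun hj => ?_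
    obtain rfl | rfl : j = r ∨ j = s + 1 := by
      rw [Set.mem_Ioc] at hj
      omega
    · simp [h.lower_bottom, h'.lower_bottom]
    · simp [h.upper_top, h'.upper_top]
  have hzero : (fun j : Fin (graphEcc Γ x) => d (j + 1)) = 0 := by
    refine hU.isParameterMatrix.eq_zero_of_mulVec_eq_zero (s := ⟨r, by omega⟩)
      (t := ⟨s - 1, by omega⟩) (fun j hj => Set.indicator_of_notMem ?_ _) fun k hrk hks => ?_
    · simp only [Fin.le_def] at hj
      rw [Set.mem_Ioc]
      omega
    · simp only [Fin.le_def] at hrk hks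
      have hks' : (k : ℕ) < s := by omega
      rw [hU.isParameterMatrix.mulVec_apply, hd k hrk (by omega), hd (k + 1) (by omega) (by omega),
        hd (k + 2) (by omega) (by omega)]
      simp only [Nat.add_succ_sub_one]
      linear_combination
        h.uniformStructure_equation hU hrk hks' - h'.uniformStructure_equation hU hrk hks'
  exact sub_eq_zero.1 ((hd (i + 1) (by omega) (by omega)).symm.trans
    (congrFun hzero ⟨i, his.trans_le hs⟩))

theorem not_supportsUniformStructure_of_isLadder {Y : Type*} [Fintype Y] {Γ' : SimpleGraph Y}
    {y : Y} {g g' : Y → ℂ} (e : Γ ≃g Γ') (he : e x = y) (h : IsLadder Γ' y r s g β γ)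
    (h' : IsLadder Γ' y r s g' β' γ') {i : ℕ} (hri : r ≤ i) (his : i < s)
    (hne : γ i * β (i + 1) ≠ γ' i * β' (i + 1)) : ¬SupportsUniformStructure Γ x := by
  subst he
  exact fun hΓ => hne ((h.comp_iso e).flatDeleted.mul_eq_mul_of_admitsUniformStructure
    (h'.comp_iso e).flatDeleted hΓ hri his)

end Uniqueness

/-! ## Harmonic functions on the Boolean lattice -/

section Boolean

variable {α R : Type*} [DecidableEq α] [CommRing R] {S : Finset α} {φ : Finset α → R} {j : ℕ}

/-- `φ` is *harmonic* of degree `j` on the subsets of `S`: under removing and adding a point it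
behaves like a homogeneous multilinear polynomial of degree `j`, annihilated by the sum of the
partial derivatives, evaluated at indicator vectors of subsets of `S`. -/
structure IsHarmonic (S : Finset α) (φ : Finset α → R) (j : ℕ) : Prop where
  sum_erase : ∀ A ⊆ S, ∑ a ∈ A, φ (A.erase a) = (A.card - j) * φ A
  sum_insert : ∀ A ⊆ S, ∑ a ∈ S \ A, φ (insert a A) = (S.card - A.card - j) * φ A

theorem isHarmonic_one (S : Finset α) : IsHarmonic S (1 : Finset α → R) 0 where
  sum_erase A _ := by simp
  sum_insert A hA := by simp [Finset.card_sdiff_of_subset hA, Finset.card_le_card hA]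

theorem IsHarmonic.mul_sum (hφ : IsHarmonic S φ j) {e : α → R} (he : ∑ a ∈ S, e a = 0)
    (hφe : ∀ A ⊆ S, ∀ a ∈ A, φ (A.erase a) * e a = φ A * e a) :
    IsHarmonic S (fun A => φ A * ∑ a ∈ A, e a) (j + 1) where
  sum_erase A hA := by
    calc ∑ a ∈ A, φ (A.erase a) * ∑ c ∈ A.erase a, e c
        = ∑ a ∈ A, (φ (A.erase a) * (∑ c ∈ A, e c) - φ A * e a) :=
          Finset.sum_congr rfl fun a ha => by
            rw [Finset.sum_erase_eq_sub ha, mul_sub, hφe A hA a ha]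
      _ = (A.card - (j + 1 : ℕ)) * (φ A * ∑ c ∈ A, e c) := by
          rw [Finset.sum_sub_distrib, ← Finset.sum_mul, ← Finset.mul_sum, hφ.sum_erase A hA]
          push_cast
          ring
  sum_insert A hA := by
    have he' : ∑ a ∈ S \ A, e a = -∑ a ∈ A, e a := by
      rw [eq_neg_iff_add_eq_zero, Finset.sum_sdiff hA, he]
    have hinsert : ∀ a ∈ S \ A, φ (insert a A) * ∑ c ∈ insert a A, e c
        = φ (insert a A) * (∑ c ∈ A, e c) + φ A * e a := by
      intro a ha
      obtain ⟨haS, haA⟩ := Finset.mem_sdiff.1 ha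
      have := hφe _ (Finset.insert_subset haS hA) a (Finset.mem_insert_self a A)
      rw [Finset.erase_insert haA] at this
      rw [Finset.sum_insert haA, this]
      ring
    rw [Finset.sum_congr rfl hinsert, Finset.sum_add_distrib, ← Finset.sum_mul, ← Finset.mul_sum,
      hφ.sum_insert A hA, he']
    push_cast
    ring

/-- The difference of the indicators of `a ∈ A` and `b ∈ A`; products of these for disjoint pairs
are the standard harmonic functions. -/
def pairDiff (a b : α) (A : Finset α) : R := (if a ∈ A then 1 else 0) - (if b ∈ A then 1 else 0)

theorem pairDiff_eq_sum (a b : α) (A : Finset α) :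
    pairDiff a b A = ∑ c ∈ A, (Pi.single a 1 - Pi.single b 1 : α → R) c := by
  simp [pairDiff, Finset.sum_sub_distrib, Pi.single_apply]

theorem IsHarmonic.mul_pairDiff (hφ : IsHarmonic S φ j) {a b : α} (ha : a ∈ S) (hb : b ∈ S)
    (hφa : ∀ A, φ (A.erase a) = φ A) (hφb : ∀ A, φ (A.erase b) = φ A) :
    IsHarmonic S (φ * pairDiff a b) (j + 1) := by
  simp only [Pi.mul_def, pairDiff_eq_sum]
  refine hφ.mul_sum (by rw [← pairDiff_eq_sum, pairDiff]; simp [ha, hb]) fun A _ c _ => ?_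
  obtain rfl | hca := eq_or_ne c a
  · rw [hφa]
  obtain rfl | hcb := eq_or_ne c b
  · rw [hφb]
  · simp [hca, hcb]

theorem isHarmonic_pairDiff {a b : α} (ha : a ∈ S) (hb : b ∈ S) :
    IsHarmonic S (pairDiff a b : Finset α → R) 1 := by
  simpa using (isHarmonic_one S).mul_pairDiff (R := R) ha hb (fun _ => rfl) fun _ => rfl

theorem exists_isHarmonic_one_singleton_ne_zero (R : Type*) [CommRing R] [Nontrivial R]
    (hS : 1 < S.card) : ∃ φ : Finset α → R, IsHarmonic S φ 1 ∧ ∃ a ∈ S, φ {a} ≠ 0 := by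
  obtain ⟨a, ha, b, hb, hab⟩ := Finset.one_lt_card.1 hS
  exact ⟨pairDiff a b, isHarmonic_pairDiff ha hb, a, ha, by simp [pairDiff, hab.symm]⟩

theorem isHarmonic_pairDiff_mul_pairDiff {a b c d : α} (ha : a ∈ S) (hb : b ∈ S) (hc : c ∈ S)
    (hd : d ∈ S) (hac : a ≠ c) (had : a ≠ d) (hbc : b ≠ c) (hbd : b ≠ d) :
    IsHarmonic S (pairDiff a b * pairDiff c d : Finset α → R) 2 :=
  (isHarmonic_pairDiff ha hb).mul_pairDiff hc hd (fun A => by simp [pairDiff, hac, hbc])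
    fun A => by simp [pairDiff, had, hbd]

theorem sum_sum_erase_pair (S : Finset α) (F : Finset α → R) :
    ∑ a ∈ S, ∑ b ∈ S.erase a, F {a, b} = 2 * ∑ u ∈ S.powersetCard 2, F u := by
  have hoff : ∑ a ∈ S, ∑ b ∈ S.erase a, F {a, b} = ∑ c ∈ S.offDiag, F {c.1, c.2} :=
    (Finset.sum_finset_product' _ _ _ fun c => by
      simp only [Finset.mem_offDiag, Finset.mem_erase]; tauto).symm
  have hmaps : ∀ c ∈ S.offDiag, ({c.1, c.2} : Finset α) ∈ S.powersetCard 2 := by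
    intro c hc
    obtain ⟨h1, h2, hne⟩ := Finset.mem_offDiag.1 hc
    exact Finset.mem_powersetCard.2 ⟨by simp [Finset.insert_subset_iff, h1, h2],
      Finset.card_pair hne⟩
  rw [hoff, ← Finset.sum_fiberwise_of_maps_to hmaps, Finset.mul_sum]
  refine Finset.sum_congr rfl fun u hu => ?_
  obtain ⟨huS, hu2⟩ := Finset.mem_powersetCard.1 hu
  have hfiber : {c ∈ S.offDiag | ({c.1, c.2} : Finset α) = u} = u.offDiag := by
    ext ⟨a, b⟩
    simp only [Finset.mem_filter, Finset.mem_offDiag]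
    constructor
    · rintro ⟨⟨-, -, hab⟩, rfl⟩
      simp [hab]
    · rintro ⟨ha, hb, hab⟩
      exact ⟨⟨huS ha, huS hb, hab⟩, Finset.eq_of_subset_of_card_le
        (by simp [Finset.insert_subset_iff, ha, hb]) (by rw [hu2, Finset.card_pair hab])⟩
  rw [Finset.sum_congr rfl fun c hc => by rw [(Finset.mem_filter.1 hc).2], Finset.sum_const,
    hfiber, Finset.offDiag_card, hu2, nsmul_eq_mul]
  norm_num

theorem IsHarmonic.two_mul_sum_sdiff (hφ : IsHarmonic S φ j) {A : Finset α} (hA : A ⊆ S) :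
    2 * ∑ u ∈ A.powersetCard 2, φ (A \ u) = (A.card - j) * (A.card - 1 - j) * φ A := by
  rw [← sum_sum_erase_pair A fun u => φ (A \ u)]
  have hinner : ∀ a ∈ A, ∑ b ∈ A.erase a, φ (A \ {a, b}) = (A.card - 1 - j) * φ (A.erase a) := by
    intro a ha
    rw [← Finset.cast_card_erase_of_mem ha, ← hφ.sum_erase _ ((A.erase_subset a).trans hA)]
    exact Finset.sum_congr rfl fun b _ => by
      rw [Finset.sdiff_insert, Finset.sdiff_singleton_eq_erase, Finset.erase_right_comm]
  rw [Finset.sum_congr rfl hinner, ← Finset.mul_sum, hφ.sum_erase A hA]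
  ring

theorem IsHarmonic.two_mul_sum_union (hφ : IsHarmonic S φ j) {A : Finset α} (hA : A ⊆ S) :
    2 * ∑ u ∈ (S \ A).powersetCard 2, φ (A ∪ u)
      = (S.card - A.card - j) * (S.card - A.card - 1 - j) * φ A := by
  rw [← sum_sum_erase_pair (S \ A) fun u => φ (A ∪ u)]
  have hinner : ∀ a ∈ S \ A, ∑ b ∈ (S \ A).erase a, φ (A ∪ {a, b})
      = (S.card - A.card - 1 - j) * φ (insert a A) := by
    intro a ha
    obtain ⟨haS, haA⟩ := Finset.mem_sdiff.1 ha
    have hcard : (S.card : R) - A.card - 1 = S.card - (insert a A).card := by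
      rw [Finset.card_insert_of_notMem haA]
      push_cast
      ring
    rw [hcard, ← hφ.sum_insert _ (Finset.insert_subset haS hA), Finset.sdiff_insert]
    exact Finset.sum_congr rfl fun b _ => by congr 1; grind
  rw [Finset.sum_congr rfl hinner, ← Finset.mul_sum, hφ.sum_insert A hA]
  ring

end Boolean

/-! ## Johnson graphs -/

theorem natCast_sub_sub_ne_zero {R : Type*} [AddCommGroupWithOne R] [CharZero R] {a b c : ℕ}
    (h : b + c < a) : (a : R) - b - c ≠ 0 := by
  rw [sub_sub, sub_ne_zero, ← Nat.cast_add]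
  exact Nat.cast_injective.ne h.ne'

section Johnson

variable {n d : ℕ}

theorem card_sdiff_insert_erase {α : Type*} [DecidableEq α] (x : Finset α) {s : Finset α}
    {a b : α} (ha : a ∉ s) (hb : b ∈ s) :
    (x \ insert a (s.erase b)).card + (if a ∈ x then 1 else 0)
      = (x \ s).card + if b ∈ x then 1 else 0 := by
  have hsdiff : x \ s.erase b = if b ∈ x then insert b (x \ s) else x \ s := by grind
  have hcard : (x \ s.erase b).card = (x \ s).card + if b ∈ x then 1 else 0 := by
    rw [hsdiff]
    split_ifs
    · exact Finset.card_insert_of_notMem (by simp [hb])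
    · rfl
  rw [Finset.sdiff_insert, ← hcard]
  split_ifs with hax
  · exact Finset.card_erase_add_one (by simp [hax, ha])
  · rw [Finset.erase_eq_of_notMem (by simp [hax])]
    rfl

theorem card_insert_erase {α : Type*} [DecidableEq α] {s : Finset α} {a b : α} (ha : a ∉ s)
    (hb : b ∈ s) : (insert a (s.erase b)).card = s.card := by
  rw [Finset.card_insert_of_notMem (mt Finset.mem_of_mem_erase ha), Finset.card_erase_add_one hb]

theorem johnsonGraph_adj_iff {s t : {s : Finset (Fin n) // s.card = d}} :
    (johnsonGraph n d).Adj s t ↔ ∃ p ∈ s.1ᶜ ×ˢ s.1, insert p.1 (s.1.erase p.2) = t.1 := by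
  obtain ⟨s, hs⟩ := s
  obtain ⟨t, ht⟩ := t
  simp only [johnsonGraph, Prod.exists, Finset.mem_product, Finset.mem_compl]
  constructor
  · intro h
    have hst := Finset.card_sdiff_add_card_inter s t
    have hts := Finset.card_sdiff_add_card_inter t s
    rw [Finset.inter_comm] at hts
    obtain ⟨a, ha⟩ := Finset.card_eq_one.1 (show (t \ s).card = 1 by omega)
    obtain ⟨b, hb⟩ := Finset.card_eq_one.1 (show (s \ t).card = 1 by omega)
    simp only [Finset.ext_iff, Finset.mem_sdiff, Finset.mem_singleton] at ha hb
    refine ⟨a, b, ⟨((ha a).2 rfl).2, ((hb b).2 rfl).1⟩, ?_⟩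
    ext c
    grind
  · rintro ⟨a, b, ⟨ha, hb⟩, rfl⟩
    rw [Finset.inter_insert_of_notMem ha, Finset.inter_eq_right.2 (Finset.erase_subset b s),
      Finset.card_erase_add_one hb, hs]

theorem johnsonGraph_dist (x s : {s : Finset (Fin n) // s.card = d}) :
    (johnsonGraph n d).dist x s = (x.1 \ s.1).card := by
  refine dist_eq_of_forall_adj (ℓ := fun s => (x.1 \ s.1).card) (by rw [Finset.sdiff_self]; rfl)
    (fun s t hst => ?_) (fun t ht => ?_) s
  · obtain ⟨⟨a, b⟩, hp, ht⟩ := johnsonGraph_adj_iff.1 hst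
    simp only [Finset.mem_product, Finset.mem_compl] at hp
    have := card_sdiff_insert_erase x.1 hp.1 hp.2
    rw [← ht]
    grind
  · have hcard : t.1.card = x.1.card := t.2.trans x.2.symm
    have hne : t.1 ≠ x.1 := fun h => ht (Subtype.ext h)
    obtain ⟨b, hbt, hbx⟩ :=
      Finset.not_subset.1 (mt (Finset.eq_of_subset_of_card_le · hcard.ge) hne)
    obtain ⟨a, hax, hat⟩ :=
      Finset.not_subset.1 (mt (Finset.eq_of_subset_of_card_le · hcard.le) hne.symm)
    let z : {s : Finset (Fin n) // s.card = d} :=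
      ⟨insert a (t.1.erase b), (card_insert_erase hat hbt).trans t.2⟩
    have htz : (johnsonGraph n d).Adj t z :=
      johnsonGraph_adj_iff.2 ⟨(a, b), by simp [hat, hbt], rfl⟩
    refine ⟨z, htz.symm, ?_⟩
    simpa [hax, hbx] using card_sdiff_insert_erase x.1 hat hbt

theorem johnsonGraph_sum_adj {M : Type*} [AddCommMonoid M]
    (s : {s : Finset (Fin n) // s.card = d}) (P : Finset (Fin n) → Prop) [DecidablePred P]
    [DecidablePred fun t => (johnsonGraph n d).Adj s t ∧ P t.1] (F : Finset (Fin n) → M) :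
    ∑ t with (johnsonGraph n d).Adj s t ∧ P t.1, F t.1
      = ∑ p ∈ s.1ᶜ ×ˢ s.1 with P (insert p.1 (s.1.erase p.2)), F (insert p.1 (s.1.erase p.2)) := by
  symm
  have hcard : ∀ p ∈ s.1ᶜ ×ˢ s.1, (insert p.1 (s.1.erase p.2)).card = d := by
    intro p hp
    obtain ⟨hp1, hp2⟩ := Finset.mem_product.1 hp
    rw [card_insert_erase (Finset.mem_compl.1 hp1) hp2, s.2]
  refine Finset.sum_bij (fun p hp => ⟨_, hcard p (Finset.mem_filter.1 hp).1⟩)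
    (fun p hp => ?_) (fun p hp q hq hpq => ?_) (fun t ht => ?_) fun _ _ => rfl
  · obtain ⟨hp, hP⟩ := Finset.mem_filter.1 hp
    exact (Finset.mem_filter_univ _).2 ⟨johnsonGraph_adj_iff.2 ⟨p, hp, rfl⟩, hP⟩
  · have hp' := Finset.ext_iff.1 (Subtype.mk.inj hpq) p.1
    have hq' := Finset.ext_iff.1 (Subtype.mk.inj hpq) q.2
    simp only [Finset.mem_filter, Finset.mem_product, Finset.mem_compl] at hp hq
    simp only [Finset.mem_insert, Finset.mem_erase] at hp' hq'
    ext1 <;> grind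
  · obtain ⟨hst, hP⟩ := (Finset.mem_filter_univ _).1 ht
    obtain ⟨p, hp, hpt⟩ := johnsonGraph_adj_iff.1 hst
    exact ⟨p, Finset.mem_filter.2 ⟨hp, hpt ▸ hP⟩, Subtype.ext hpt⟩

variable {R : Type*} [CommRing R] {x : {s : Finset (Fin n) // s.card = d}}
  {φ ψ : Finset (Fin n) → R} {j j' : ℕ}

open Classical in
theorem johnsonGraph_sum_lower (hφ : IsHarmonic x.1 φ j) (hψ : IsHarmonic x.1ᶜ ψ j')
    (s : {s : Finset (Fin n) // s.card = d}) :
    ∑ t with (johnsonGraph n d).Adj s t ∧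
        (johnsonGraph n d).dist x t + 1 = (johnsonGraph n d).dist x s,
      φ (x.1 \ t.1) * ψ (t.1 \ x.1)
      = (((johnsonGraph n d).dist x s : R) - j) * ((johnsonGraph n d).dist x s - j')
        * (φ (x.1 \ s.1) * ψ (s.1 \ x.1)) := by
  have hcard : (s.1 \ x.1).card = (x.1 \ s.1).card :=
    Finset.card_sdiff_comm (s.2.trans x.2.symm)
  have hsub : s.1 \ x.1 ⊆ x.1ᶜ := fun a ha => Finset.mem_compl.2 (Finset.mem_sdiff.1 ha).2
  have hlower : {p ∈ s.1ᶜ ×ˢ s.1 | (x.1 \ insert p.1 (s.1.erase p.2)).card + 1 = (x.1 \ s.1).card}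
      = (x.1 \ s.1) ×ˢ (s.1 \ x.1) := by
    ext p
    simp only [Finset.mem_filter, Finset.mem_product, Finset.mem_compl, Finset.mem_sdiff]
    have := card_sdiff_insert_erase x.1 (s := s.1) (a := p.1) (b := p.2)
    grind
  have hterm : ∀ p ∈ (x.1 \ s.1) ×ˢ (s.1 \ x.1),
      φ (x.1 \ insert p.1 (s.1.erase p.2)) * ψ (insert p.1 (s.1.erase p.2) \ x.1)
        = φ ((x.1 \ s.1).erase p.1) * ψ ((s.1 \ x.1).erase p.2) := by
    intro p hp
    simp only [Finset.mem_product, Finset.mem_sdiff] at hp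
    congr 2 <;> grind
  simp only [johnsonGraph_dist]
  rw [johnsonGraph_sum_adj s (fun t => (x.1 \ t).card + 1 = (x.1 \ s.1).card)
    fun t => φ (x.1 \ t) * ψ (t \ x.1), hlower, Finset.sum_congr rfl hterm, Finset.sum_product]
  simp only [← Finset.sum_mul_sum]
  rw [hφ.sum_erase _ Finset.sdiff_subset, hψ.sum_erase _ hsub, hcard]
  ring

open Classical in
theorem johnsonGraph_sum_upper (hφ : IsHarmonic x.1 φ j) (hψ : IsHarmonic x.1ᶜ ψ j')
    (s : {s : Finset (Fin n) // s.card = d}) :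
    ∑ t with (johnsonGraph n d).Adj s t ∧
        (johnsonGraph n d).dist x t = (johnsonGraph n d).dist x s + 1,
      φ (x.1 \ t.1) * ψ (t.1 \ x.1)
      = ((d : R) - (johnsonGraph n d).dist x s - j)
        * (((n - d : ℕ) : R) - (johnsonGraph n d).dist x s - j')
        * (φ (x.1 \ s.1) * ψ (s.1 \ x.1)) := by
  have hcard : (s.1 \ x.1).card = (x.1 \ s.1).card :=
    Finset.card_sdiff_comm (s.2.trans x.2.symm)
  have hsub : s.1 \ x.1 ⊆ x.1ᶜ := fun a ha => Finset.mem_compl.2 (Finset.mem_sdiff.1 ha).2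
  have hcompl : x.1ᶜ.card = n - d := by rw [Finset.card_compl, Fintype.card_fin, x.2]
  have hupper : {p ∈ s.1ᶜ ×ˢ s.1 | (x.1 \ insert p.1 (s.1.erase p.2)).card = (x.1 \ s.1).card + 1}
      = (x.1ᶜ \ (s.1 \ x.1)) ×ˢ (x.1 \ (x.1 \ s.1)) := by
    ext p
    simp only [Finset.mem_filter, Finset.mem_product, Finset.mem_compl, Finset.mem_sdiff]
    have := card_sdiff_insert_erase x.1 (s := s.1) (a := p.1) (b := p.2)
    grind
  have hterm : ∀ p ∈ (x.1ᶜ \ (s.1 \ x.1)) ×ˢ (x.1 \ (x.1 \ s.1)),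
      φ (x.1 \ insert p.1 (s.1.erase p.2)) * ψ (insert p.1 (s.1.erase p.2) \ x.1)
        = φ (insert p.2 (x.1 \ s.1)) * ψ (insert p.1 (s.1 \ x.1)) := by
    intro p hp
    simp only [Finset.mem_product, Finset.mem_sdiff, Finset.mem_compl] at hp
    congr 2 <;> grind
  simp only [johnsonGraph_dist]
  rw [johnsonGraph_sum_adj s (fun t => (x.1 \ t).card = (x.1 \ s.1).card + 1)
    fun t => φ (x.1 \ t) * ψ (t \ x.1), hupper, Finset.sum_congr rfl hterm,
    Finset.sum_product_right]
  simp only [← Finset.sum_mul_sum]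
  rw [hφ.sum_insert _ Finset.sdiff_subset, hψ.sum_insert _ hsub, hcard, hcompl, x.2]
  ring

theorem isLadder_johnsonGraph [IsDomain R] [CharZero R] (hφ : IsHarmonic x.1 φ j)
    (hψ : IsHarmonic x.1ᶜ ψ j') {r t : ℕ} (hr : r = j ∨ r = j') (htd : t + j ≤ d)
    (htn : t + j' ≤ n - d) (ht : t + j = d ∨ t + j' = n - d) {A B : Finset (Fin n)}
    (hA : A ⊆ x.1) (hAr : A.card = r) (hφA : φ A ≠ 0) (hB : B ⊆ x.1ᶜ) (hBr : B.card = r)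
    (hψB : ψ B ≠ 0) :
    IsLadder (johnsonGraph n d) x r t (fun s => φ (x.1 \ s.1) * ψ (s.1 \ x.1))
      (fun i => ((i : R) - j) * (i - j'))
      (fun i => ((d : R) - i - j) * (((n - d : ℕ) : R) - i - j')) where
  sum_lower := johnsonGraph_sum_lower hφ hψ
  sum_upper := johnsonGraph_sum_upper hφ hψ
  lower_bottom := by rcases hr with rfl | rfl <;> simp
  upper_top := by rcases ht with ht | ht <;> simp [← ht]
  upper_ne_zero i _ hi := mul_ne_zero (natCast_sub_sub_ne_zero (by omega))
    (natCast_sub_sub_ne_zero (by omega))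
  bottom_ne_zero := by
    have hBx : ∀ b ∈ B, b ∉ x.1 := fun b hb => Finset.mem_compl.1 (hB hb)
    have hdisj : Disjoint (x.1 \ A) B :=
      Finset.disjoint_right.2 fun b hb => mt (Finset.sdiff_subset ·) (hBx b hb)
    have hcard : (x.1 \ A ∪ B).card = d := by
      rw [Finset.card_union_of_disjoint hdisj, hBr, ← hAr, Finset.card_sdiff_add_card_eq_card hA,
        x.2]
    have hsdiff : x.1 \ (x.1 \ A ∪ B) = A := by grind
    have hsdiff' : (x.1 \ A ∪ B) \ x.1 = B := by grind
    exact ⟨⟨_, hcard⟩, by rw [johnsonGraph_dist, hsdiff, hAr],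
      by simpa only [hsdiff, hsdiff'] using mul_ne_zero hφA hψB⟩

theorem not_supportsUniformStructure_of_iso_johnsonGraph {X : Type*} [Fintype X] [DecidableEq X]
    {Γ : SimpleGraph X} (hd : 3 ≤ d) (hdn : d + 3 ≤ n) (e : Γ ≃g johnsonGraph n d) (v : X) :
    ¬SupportsUniformStructure Γ v := by
  obtain ⟨x, hx⟩ : ∃ x, e v = x := ⟨_, rfl⟩
  have hcompl : x.1ᶜ.card = n - d := by rw [Finset.card_compl, Fintype.card_fin, x.2]
  obtain ⟨φ, hφ, a, ha, hφa⟩ := exists_isHarmonic_one_singleton_ne_zero ℂ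
    (show 1 < x.1.card by omega)
  obtain ⟨ψ, hψ, b, hb, hψb⟩ := exists_isHarmonic_one_singleton_ne_zero ℂ
    (show 1 < x.1ᶜ.card by omega)
  have hA := Finset.singleton_subset_iff.2 ha
  have hB := Finset.singleton_subset_iff.2 hb
  have hd2 : (d : ℂ) - (1 : ℕ) - (1 : ℕ) ≠ 0 := natCast_sub_sub_ne_zero (by omega)
  have hn2 : ((n - d : ℕ) : ℂ) - (1 : ℕ) - (1 : ℕ) ≠ 0 := natCast_sub_sub_ne_zero (by omega)
  obtain hdn' | hdn' := le_total d (n - d)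
  · refine not_supportsUniformStructure_of_isLadder e hx (r := 1) (s := d - 1) (i := 1)
      (isLadder_johnsonGraph hφ hψ (by simp) (by omega) (by omega) (by omega) hA rfl hφa hB rfl hψb)
      (isLadder_johnsonGraph hφ (isHarmonic_one _) (by simp) (by omega) (by omega) (by omega)
        hA rfl hφa hB rfl one_ne_zero) le_rfl (by omega) fun h => ?_
    have hn0 : ((n - d : ℕ) : ℂ) ≠ 0 := Nat.cast_ne_zero.2 (by omega)
    refine mul_ne_zero hd2 hn0 ?_
    push_cast at h ⊢
    linear_combination -h
  · refine not_supportsUniformStructure_of_isLadder e hx (r := 1) (s := n - d - 1) (i := 1)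
      (isLadder_johnsonGraph hφ hψ (by simp) (by omega) (by omega) (by omega) hA rfl hφa hB rfl hψb)
      (isLadder_johnsonGraph (isHarmonic_one _) hψ (by simp) (by omega) (by omega) (by omega)
        hA rfl one_ne_zero hB rfl hψb) le_rfl (by omega) fun h => ?_
    have hd0 : (d : ℂ) ≠ 0 := Nat.cast_ne_zero.2 (by omega)
    refine mul_ne_zero hd0 hn2 ?_
    push_cast at h ⊢
    linear_combination -h

end Johnson

/-! ## Halved cubes -/

section HalvedCube

open scoped symmDiff

variable {α : Type*} [DecidableEq α]

theorem card_symmDiff_add_two_mul_card_inter (s t : Finset α) :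
    (s ∆ t).card + 2 * (s ∩ t).card = s.card + t.card := by
  have hdisj : Disjoint (s \ t) (t \ s) := disjoint_sdiff_sdiff
  have hsymm : (s ∆ t).card = (s \ t).card + (t \ s).card := Finset.card_union_of_disjoint hdisj
  have hs := Finset.card_sdiff_add_card_inter s t
  have ht := Finset.card_sdiff_add_card_inter t s
  rw [Finset.inter_comm] at ht
  omega

/-- The graph of even-size subsets of `α`, adjacent when they differ in two elements: the halved
cube in terms of supports of words, so that distances from the zero word become sizes of sets. -/
def evenSetGraph (α : Type*) [DecidableEq α] : SimpleGraph {s : Finset α // Even s.card} where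
  Adj s t := (s.1 ∆ t.1).card = 2
  symm := ⟨fun s t h => by rwa [symmDiff_comm]⟩
  loopless := ⟨fun s h => by simp at h⟩

theorem evenSetGraph_adj_iff {s t : {s : Finset α // Even s.card}} :
    (evenSetGraph α).Adj s t ↔ ∃ u : Finset α, u.card = 2 ∧ s.1 ∆ u = t.1 := by
  constructor
  · exact fun h => ⟨_, h, symmDiff_symmDiff_cancel_left _ _⟩
  · rintro ⟨u, hu, h⟩
    change (s.1 ∆ t.1).card = 2
    rw [← h, symmDiff_symmDiff_cancel_left, hu]

theorem even_card_symmDiff {s u : Finset α} (hs : Even s.card) (hu : Even u.card) :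
    Even (s ∆ u).card := by
  have := card_symmDiff_add_two_mul_card_inter s u
  grind

theorem two_mul_evenSetGraph_dist (s : {s : Finset α // Even s.card}) :
    2 * (evenSetGraph α).dist ⟨∅, Even.zero⟩ s = s.1.card := by
  rw [dist_eq_of_forall_adj (ℓ := fun s : {s : Finset α // Even s.card} => s.1.card / 2) (by simp)
    (fun s t hst => ?_) (fun t ht => ?_) s, Nat.two_mul_div_two_of_even s.2]
  · obtain ⟨u, hu, ht⟩ := evenSetGraph_adj_iff.1 hst
    have := card_symmDiff_add_two_mul_card_inter s.1 u
    simp only [← ht]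
    omega
  · have hne : t.1.card ≠ 0 := fun h => ht (Subtype.ext (Finset.card_eq_zero.1 h))
    have htwo : 2 ≤ t.1.card := by
      obtain ⟨m, hm⟩ := t.2
      omega
    obtain ⟨u, hut, hu⟩ := Finset.exists_subset_card_eq htwo
    have hcard : (t.1 ∆ u).card + 2 * 2 = t.1.card + 2 := by
      have := card_symmDiff_add_two_mul_card_inter t.1 u
      rwa [Finset.inter_eq_right.2 hut, hu] at this
    have htz : (evenSetGraph α).Adj t ⟨t.1 ∆ u, even_card_symmDiff t.2 (hu ▸ even_two)⟩ :=
      evenSetGraph_adj_iff.2 ⟨u, hu, rfl⟩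
    exact ⟨_, htz.symm, by simp only; omega⟩

variable [Fintype α]

theorem evenSetGraph_sum_adj {M : Type*} [AddCommMonoid M]
    (s : {s : Finset α // Even s.card}) (P : Finset α → Prop) [DecidablePred P]
    [DecidablePred fun t => (evenSetGraph α).Adj s t ∧ P t.1] (F : Finset α → M) :
    ∑ t with (evenSetGraph α).Adj s t ∧ P t.1, F t.1
      = ∑ u ∈ Finset.univ.powersetCard 2 with P (s.1 ∆ u), F (s.1 ∆ u) := by
  symm
  have heven : ∀ u ∈ ({u ∈ Finset.univ.powersetCard 2 | P (s.1 ∆ u)} : Finset (Finset α)),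
      Even (s.1 ∆ u).card := fun u hu =>
    even_card_symmDiff s.2
      (Finset.mem_powersetCard_univ.1 (Finset.mem_filter.1 hu).1 ▸ even_two)
  refine Finset.sum_bij (fun u hu => ⟨s.1 ∆ u, heven u hu⟩) (fun u hu => ?_)
    (fun u _ v _ huv => symmDiff_right_injective _ (Subtype.mk.inj huv)) (fun t ht => ?_)
    fun _ _ => rfl
  · obtain ⟨hu, hP⟩ := Finset.mem_filter.1 hu
    exact (Finset.mem_filter_univ _).2
      ⟨evenSetGraph_adj_iff.2 ⟨u, Finset.mem_powersetCard_univ.1 hu, rfl⟩, hP⟩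
  · obtain ⟨hst, hP⟩ := (Finset.mem_filter_univ _).1 ht
    obtain ⟨u, hu, hut⟩ := evenSetGraph_adj_iff.1 hst
    exact ⟨u, Finset.mem_filter.2 ⟨Finset.mem_powersetCard_univ.2 hu, hut ▸ hP⟩, Subtype.ext hut⟩

variable {K : Type*} [Field K] [CharZero K] {φ : Finset α → K} {j : ℕ}

open Classical in
theorem evenSetGraph_sum_lower (hφ : IsHarmonic Finset.univ φ j)
    (s : {s : Finset α // Even s.card}) :
    ∑ t with (evenSetGraph α).Adj s t ∧
        (evenSetGraph α).dist ⟨∅, Even.zero⟩ t + 1 = (evenSetGraph α).dist ⟨∅, Even.zero⟩ s, φ t.1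
      = (s.1.card - j) * (s.1.card - 1 - j) / 2 * φ s.1 := by
  have hlayer (t : {s : Finset α // Even s.card}) : (evenSetGraph α).dist ⟨∅, Even.zero⟩ t + 1
      = (evenSetGraph α).dist ⟨∅, Even.zero⟩ s ↔ t.1.card + 2 = s.1.card := by
    rw [← two_mul_evenSetGraph_dist, ← two_mul_evenSetGraph_dist]
    omega
  have hlower : {u ∈ (Finset.univ : Finset α).powersetCard 2 | (s.1 ∆ u).card + 2 = s.1.card}
      = s.1.powersetCard 2 := by
    ext u
    rw [Finset.mem_filter, Finset.mem_powersetCard_univ, Finset.mem_powersetCard,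
      ← Finset.inter_eq_right]
    have := card_symmDiff_add_two_mul_card_inter s.1 u
    have : s.1 ∩ u = u ↔ (s.1 ∩ u).card = u.card :=
      ⟨congrArg _, fun h => Finset.eq_of_subset_of_card_le Finset.inter_subset_right h.ge⟩
    grind
  have hterm : ∀ u ∈ s.1.powersetCard 2, φ (s.1 ∆ u) = φ (s.1 \ u) := fun u hu => by
    rw [symmDiff_of_ge (Finset.mem_powersetCard.1 hu).1]
  simp only [hlayer]
  rw [evenSetGraph_sum_adj s (fun t => t.card + 2 = s.1.card) φ, hlower, Finset.sum_congr rfl hterm]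
  linear_combination hφ.two_mul_sum_sdiff (Finset.subset_univ s.1) / 2

open Classical in
theorem evenSetGraph_sum_upper (hφ : IsHarmonic Finset.univ φ j)
    (s : {s : Finset α // Even s.card}) :
    ∑ t with (evenSetGraph α).Adj s t ∧
        (evenSetGraph α).dist ⟨∅, Even.zero⟩ t = (evenSetGraph α).dist ⟨∅, Even.zero⟩ s + 1, φ t.1
      = (Fintype.card α - s.1.card - j) * (Fintype.card α - s.1.card - 1 - j) / 2 * φ s.1 := by
  have hlayer (t : {s : Finset α // Even s.card}) : (evenSetGraph α).dist ⟨∅, Even.zero⟩ t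
      = (evenSetGraph α).dist ⟨∅, Even.zero⟩ s + 1 ↔ t.1.card = s.1.card + 2 := by
    rw [← two_mul_evenSetGraph_dist, ← two_mul_evenSetGraph_dist]
    omega
  have hupper : {u ∈ (Finset.univ : Finset α).powersetCard 2 | (s.1 ∆ u).card = s.1.card + 2}
      = (Finset.univ \ s.1).powersetCard 2 := by
    ext u
    simp only [Finset.mem_filter, Finset.mem_powersetCard, Finset.subset_univ, true_and,
      Finset.subset_sdiff, disjoint_comm (a := u), Finset.disjoint_iff_inter_eq_empty,
      ← Finset.card_eq_zero]
    have := card_symmDiff_add_two_mul_card_inter s.1 u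
    grind
  have hterm : ∀ u ∈ (Finset.univ \ s.1).powersetCard 2, φ (s.1 ∆ u) = φ (s.1 ∪ u) := fun u hu => by
    have hdisj := (Finset.subset_sdiff.1 (Finset.mem_powersetCard.1 hu).1).2
    rw [hdisj.symm.symmDiff_eq_sup, Finset.sup_eq_union]
  simp only [hlayer]
  rw [evenSetGraph_sum_adj s (fun t => t.card = s.1.card + 2) φ, hupper,
    Finset.sum_congr rfl hterm]
  have := hφ.two_mul_sum_union (Finset.subset_univ s.1)
  rw [Finset.card_univ] at this
  linear_combination this / 2

theorem isLadder_evenSetGraph (hφ : IsHarmonic Finset.univ φ j) {r t : ℕ}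
    (hr : 2 * r = j ∨ 2 * r = j + 1)
    (ht : 2 * t + j = Fintype.card α ∨ 2 * t + j + 1 = Fintype.card α) {A : Finset α}
    (hA : A.card = 2 * r) (hφA : φ A ≠ 0) :
    IsLadder (evenSetGraph α) ⟨∅, Even.zero⟩ r t (fun s => φ s.1)
      (fun i => ((2 * i : ℕ) - j) * ((2 * i : ℕ) - 1 - j) / 2)
      (fun i => (Fintype.card α - (2 * i : ℕ) - j) * (Fintype.card α - (2 * i : ℕ) - 1 - j) / 2)
      where
  sum_lower s := by rw [evenSetGraph_sum_lower hφ, two_mul_evenSetGraph_dist]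
  sum_upper s := by rw [evenSetGraph_sum_upper hφ, two_mul_evenSetGraph_dist]
  lower_bottom := by rcases hr with hr | hr <;> simp [hr]
  upper_top := by rcases ht with ht | ht <;> simp [← ht, sub_sub]
  upper_ne_zero i _ hi := by
    have h0 : (Fintype.card α : K) - (2 * i : ℕ) - j ≠ 0 := natCast_sub_sub_ne_zero (by omega)
    have h1 : (Fintype.card α : K) - (2 * i : ℕ) - (j + 1 : ℕ) ≠ 0 :=
      natCast_sub_sub_ne_zero (by omega)
    refine div_ne_zero (mul_ne_zero h0 ?_) two_ne_zero
    rwa [sub_right_comm, sub_sub, ← Nat.cast_succ]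
  bottom_ne_zero := by
    refine ⟨⟨A, r, by omega⟩, ?_, hφA⟩
    have := two_mul_evenSetGraph_dist (⟨A, r, by omega⟩ : {s : Finset α // Even s.card})
    simp only at this
    omega

theorem not_supportsUniformStructure_of_iso_evenSetGraph {X : Type*} [Fintype X]
    [DecidableEq X] {Γ : SimpleGraph X} (heven : Even (Fintype.card α)) (hα : 6 ≤ Fintype.card α)
    (e : Γ ≃g evenSetGraph α) {x : X} (hx : e x = ⟨∅, Even.zero⟩) :
    ¬SupportsUniformStructure Γ x := by
  obtain ⟨p⟩ := Function.Embedding.nonempty_of_card_le (α := Fin 4) (β := α)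
    (by rw [Fintype.card_fin]; omega)
  have hp {a b : Fin 4} (hab : a ≠ b) : p a ≠ p b := p.injective.ne hab
  have hmem (a : Fin 4) : p a ∈ Finset.univ := Finset.mem_univ _
  have hφ : IsHarmonic Finset.univ (pairDiff (p 0) (p 1) : Finset α → ℂ) 1 :=
    isHarmonic_pairDiff (hmem 0) (hmem 1)
  have hψ : IsHarmonic Finset.univ
      (pairDiff (p 0) (p 1) * pairDiff (p 2) (p 3) : Finset α → ℂ) 2 :=
    isHarmonic_pairDiff_mul_pairDiff (hmem 0) (hmem 1) (hmem 2) (hmem 3) (hp (by decide))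
      (hp (by decide)) (hp (by decide)) (hp (by decide))
  have hA : ({p 0, p 2} : Finset α).card = 2 * 1 := Finset.card_pair (hp (by decide))
  obtain ⟨m, hm⟩ := heven
  refine not_supportsUniformStructure_of_isLadder e hx (r := 1) (s := m - 1) (i := 1)
    (isLadder_evenSetGraph hφ (by omega) (by omega) hA (by simp [pairDiff]))
    (isLadder_evenSetGraph hψ (by omega) (by omega) hA (by simp [pairDiff])) le_rfl (by omega)
    fun h => ?_
  have h2 : (Fintype.card α : ℂ) - 2 ≠ 0 :=
    sub_ne_zero.2 (by exact_mod_cast (show Fintype.card α ≠ 2 by omega))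
  have h4 : (Fintype.card α : ℂ) - 4 ≠ 0 :=
    sub_ne_zero.2 (by exact_mod_cast (show Fintype.card α ≠ 4 by omega))
  refine mul_ne_zero h4 h2 ?_
  push_cast at h
  linear_combination h

theorem even_hammingNorm_iff {ι : Type*} [Fintype ι] {v : ι → ZMod 2} :
    Even (hammingNorm v) ↔ ∑ i, v i = 0 := by
  have hv : ∀ a : ZMod 2, a = if a ≠ 0 then 1 else 0 := by decide
  rw [← ZMod.natCast_eq_zero_iff_even, Finset.sum_congr rfl fun i _ => hv (v i), Finset.sum_boole,
    hammingNorm]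

/-- The isomorphism that translates the word `x` to the zero word and takes supports. -/
def halvedCubeIso {n : ℕ} (x : {v : Fin n → ZMod 2 // Even (hammingNorm v)}) :
    halvedCube n ≃g evenSetGraph (Fin n) where
  toFun v := ⟨({i | v.1 i - x.1 i ≠ 0} : Finset (Fin n)), by
    change Even (hammingNorm (v.1 - x.1))
    simp [even_hammingNorm_iff, even_hammingNorm_iff.1 v.2, even_hammingNorm_iff.1 x.2]⟩
  invFun s := ⟨fun i => x.1 i + if i ∈ s.1 then 1 else 0, by
    rw [even_hammingNorm_iff, Finset.sum_add_distrib, even_hammingNorm_iff.1 x.2]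
    simpa [ZMod.natCast_eq_zero_iff_even] using s.2⟩
  left_inv v := by
    have h : ∀ a b : ZMod 2, (a + if b - a ≠ 0 then 1 else 0) = b := by decide
    ext i
    simp only [Finset.mem_filter_univ, h]
  right_inv s := by
    ext i
    simp
  map_rel_iff' {u v} := by
    have h : ∀ a b c : ZMod 2,
        (b - a ≠ 0 ∧ ¬c - a ≠ 0 ∨ c - a ≠ 0 ∧ ¬b - a ≠ 0) ↔ b ≠ c := by decide
    have hsymm : ({i | u.1 i - x.1 i ≠ 0} : Finset (Fin n)) ∆ ({i | v.1 i - x.1 i ≠ 0} : Finset _)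
        = ({i | u.1 i ≠ v.1 i} : Finset _) := by
      ext i
      simp only [Finset.mem_symmDiff, Finset.mem_filter_univ, h]
    change (_ ∆ _ : Finset (Fin n)).card = 2 ↔ _
    rw [Equiv.coe_fn_mk, hsymm]
    rfl

theorem halvedCubeIso_self {n : ℕ} (x : {v : Fin n → ZMod 2 // Even (hammingNorm v)}) :
    halvedCubeIso x x = ⟨∅, Even.zero⟩ :=
  Subtype.ext (by simp [halvedCubeIso])

theorem not_supportsUniformStructure_of_iso_halvedCube {X : Type*} [Fintype X] [DecidableEq X]
    {Γ : SimpleGraph X} {n : ℕ} (hn : Even n) (hn6 : 6 ≤ n) (e : Γ ≃g halvedCube n) (x : X) :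
    ¬SupportsUniformStructure Γ x :=
  not_supportsUniformStructure_of_iso_evenSetGraph (by simpa using hn) (by simpa using hn6)
    (e.trans (halvedCubeIso (e x))) (halvedCubeIso_self (e x))

end HalvedCube

/-! ## The Gosset graph -/

section Gosset

instance : DecidableRel gossetGraph.Adj := fun u v =>
  inferInstanceAs (Decidable ((u.1 = v.1 ∧ (u.2.1 ∩ v.2.1).card = 1) ∨
    (u.1 ≠ v.1 ∧ Disjoint u.2.1 v.2.1)))

/-- The vertex of the Gosset graph from which distances are computed; any vertex would do, the
graph being vertex-transitive. -/
def gossetBase : Bool × {s : Finset (Fin 8) // s.card = 2} := (false, ⟨{0, 1}, rfl⟩)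

/-- The distance from `gossetBase` in the Gosset graph, in closed form; the truncated subtraction
is exact because the intersection has at most two elements. -/
def gossetLayer (y : Bool × {s : Finset (Fin 8) // s.card = 2}) : ℕ :=
  if y.1 then 1 + (y.2.1 ∩ {0, 1}).card else 2 - (y.2.1 ∩ {0, 1}).card

theorem gossetGraph_dist (y : Bool × {s : Finset (Fin 8) // s.card = 2}) :
    gossetGraph.dist gossetBase y = gossetLayer y :=
  dist_eq_of_forall_adj (by decide) (by decide +kernel) (by decide +kernel) y

theorem isLadder_gossetGraph {g : Bool × {s : Finset (Fin 8) // s.card = 2} → ℤ} {θ : ℤ}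
    (hθ : θ ≠ 0)
    (hlower : ∀ y, ∑ z with gossetGraph.Adj y z ∧ gossetLayer z + 1 = gossetLayer y, g z
      = (if gossetLayer y = 2 then θ else 0) * g y)
    (hupper : ∀ y, ∑ z with gossetGraph.Adj y z ∧ gossetLayer z = gossetLayer y + 1, g z
      = (if gossetLayer y = 1 then θ else 0) * g y)
    (hbottom : ∃ y, gossetLayer y = 1 ∧ g y ≠ 0) :
    IsLadder gossetGraph gossetBase 1 2 g (fun i => if i = 2 then θ else 0)
      (fun i => if i = 1 then θ else 0) where
  sum_lower y := by simpa only [gossetGraph_dist, Finset.sum_filter] using hlower y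
  sum_upper y := by simpa only [gossetGraph_dist, Finset.sum_filter] using hupper y
  lower_bottom := rfl
  upper_top := rfl
  upper_ne_zero i _ _ := by
    obtain rfl : i = 1 := by omega
    simpa using hθ
  bottom_ne_zero := by simpa only [gossetGraph_dist] using hbottom

-- When antipodes are identified, adjacency between the two middle layers becomes the strongly
-- regular graph with parameters (27, 10, 1, 5), whose nontrivial eigenvalues are -5 and 1.
theorem isLadder_gossetGraph_pairDiff :
    IsLadder gossetGraph gossetBase 1 2 (fun y => (pairDiff 0 1 y.2.1 : ℤ))
      (fun i => if i = 2 then -5 else 0) (fun i => if i = 1 then -5 else 0) :=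
  isLadder_gossetGraph (by decide) (by decide +kernel) (by decide +kernel) (by decide +kernel)

theorem isLadder_gossetGraph_pairDiff_mul_pairDiff :
    IsLadder gossetGraph gossetBase 1 2 (fun y => (pairDiff 0 1 y.2.1 * pairDiff 2 3 y.2.1 : ℤ))
      (fun i => if i = 2 then 1 else 0) (fun i => if i = 1 then 1 else 0) :=
  isLadder_gossetGraph (by decide) (by decide +kernel) (by decide +kernel) (by decide +kernel)

/-- The automorphism of the Gosset graph induced by a permutation of the eight points, followed by
exchanging the two copies if `c` is true. -/
def gossetIso (c : Bool) (σ : Equiv.Perm (Fin 8)) : gossetGraph ≃g gossetGraph where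
  toFun y := (xor y.1 c, ⟨y.2.1.map σ.toEmbedding, by rw [Finset.card_map, y.2.2]⟩)
  invFun y := (xor y.1 c, ⟨y.2.1.map σ.symm.toEmbedding, by rw [Finset.card_map, y.2.2]⟩)
  left_inv y := by ext <;> simp
  right_inv y := by ext <;> simp
  map_rel_iff' := by simp [gossetGraph, ← Finset.map_inter]

theorem exists_gossetIso_apply_eq_gossetBase (y : Bool × {s : Finset (Fin 8) // s.card = 2}) :
    ∃ (c : Bool) (σ : Equiv.Perm (Fin 8)), gossetIso c σ y = gossetBase := by
  obtain ⟨σ, hσ⟩ := Equiv.Perm.exists_map_finset_eq _ _ (y.2.2.trans gossetBase.2.2.symm)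
  exact ⟨y.1, σ, Prod.ext (Bool.xor_self _) (Subtype.ext hσ)⟩

theorem not_supportsUniformStructure_of_iso_gossetGraph {X : Type*} [Fintype X] [DecidableEq X]
    {Γ : SimpleGraph X} (e : Γ ≃g gossetGraph) (x : X) : ¬SupportsUniformStructure Γ x := by
  obtain ⟨c, σ, hσ⟩ := exists_gossetIso_apply_eq_gossetBase (e x)
  exact not_supportsUniformStructure_of_isLadder (e.trans (gossetIso c σ)) hσ
    (isLadder_gossetGraph_pairDiff.map (Int.castRingHom ℂ).injective_int)
    (isLadder_gossetGraph_pairDiff_mul_pairDiff.map (Int.castRingHom ℂ).injective_int)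
    le_rfl one_lt_two (by norm_num)

end Gosset

theorem corollary9p3_general {X : Type*} [Fintype X] [DecidableEq X] (Γ : SimpleGraph X) (x : X)
    (hΓ : (∃ n d : ℕ, 3 ≤ d ∧ d + 3 ≤ n ∧ Nonempty (Γ ≃g johnsonGraph n d)) ∨
      Nonempty (Γ ≃g gossetGraph) ∨
      (∃ n : ℕ, Even n ∧ 6 ≤ n ∧ Nonempty (Γ ≃g halvedCube n))) :
    ¬ SupportsUniformStructure Γ x := by
  obtain ⟨n, d, hd, hdn, ⟨e⟩⟩ | ⟨⟨e⟩⟩ | ⟨n, hn, hn6, ⟨e⟩⟩ := hΓ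
  · exact not_supportsUniformStructure_of_iso_johnsonGraph hd hdn e x
  · exact not_supportsUniformStructure_of_iso_gossetGraph e x
  · exact not_supportsUniformStructure_of_iso_halvedCube hn hn6 e x

theorem corollary9p3 {X : Type*} [Fintype X] [DecidableEq X] (Γ : SimpleGraph X) (x : X)
    (hΓ : (∃ D : ℕ, 3 ≤ D ∧ Nonempty (Γ ≃g johnsonGraph (2 * D) D)) ∨
      Nonempty (Γ ≃g gossetGraph) ∨
      (∃ n : ℕ, Even n ∧ 6 ≤ n ∧ Nonempty (Γ ≃g halvedCube n))) :
    ¬ SupportsUniformStructure Γ x :=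
  corollary9p3_general Γ x <| hΓ.imp_left fun ⟨D, hD, e⟩ => ⟨2 * D, D, hD, by omega, e⟩
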